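/- Let $S_2\wr S_5=(\mathbb Z/2)^5\rtimes S_5$ be the group of signed permutations of the symbols $[e_1],\dots,[e_5]$, let $W=(\mathbb Z/2\mathbb Z)^4\rtimes S_5\cong W(D_5)$ be its subgroup of elements with an even number of sign changes, and let $p\colon S_2\wr S_5\to S_5$ be the projection. Let $\mathfrak P\subset\bigoplus_{i=1}^5\mathbb Q[e_i]$ be the lattice generated by $[e_1],\dots,[e_5]$ and $\frac12([e_1]+\cdots+[e_5])$, with the natural operation of $S_2\wr S_5$. For a subgroup $G\subseteq W$ and $c\in\mathfrak P$ that is $G$-invariant modulo $4\mathfrak P$, let $\iota_4^G(\bar c)\in H^1(G,\mathfrak P)$ be the image of $\bar c\in H^0(G,\mathfrak P/4\mathfrak P)$ under the connecting homomorphism of $0\to\mathfrak P\xrightarrow{4}\mathfrak P\to\mathfrak P/4\mathfrak P\to0$. A class is a proper $4$-torsion class if it is annihilated by $4$ but not by $2$. An orbit $O\subseteq\{1,\dots,5\}$ of $p(G)$ is called non-split if $G$ acts transitively on $\{\pm[e_i]:i\in O\}$, and split if this set has exactly two $G$-orbits. Let $\tau$ be the element $[e_4]\mapsto[e_5]\mapsto-[e_4]$,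 $[e_i]\mapsto-[e_i]$ for $i=1,2,3$, which is of order $4$ and commutes with the group $S_3$ of permutations of the indices $1,2,3$; this gives $S_3\times\langle\tau\rangle\cong S_3\times\mathbb Z/4\mathbb Z\subset W$. Let $s\colon S_3\times\langle\tau\rangle\to\langle\tau\rangle\cong\mathbb Z/4\mathbb Z$ be the projection. Let $G\subseteq W$ be a subgroup. * A class $\alpha\in H^1(G,\mathfrak P)$ is the $4$-torsion class of type I if $G\subseteq S_3\times\langle\tau\rangle$, $s(G)=\mathbb Z/4\mathbb Z$, and $\alpha=\iota_4^G(\overline{[e_1]+[e_2]+[e_3]+2[e_4]})$. * It is the $4$-torsion class of type II if every $p(\sigma)$, $\sigma\in G$, fixes $1$ and respects the block system $\{\{2,4\},\{3,5\}\}$; $p(\sigma)$ interchanges the two blocks if and only if $\sigma[e_1]=-[e_1]$; there is some $\sigma\in G$ with $\sigma[e_1]=-[e_1]$; and $\alpha=\iota_4^G(\overline{[e_1]+2[e_2]+2[e_4]})$. In both cases the conditions are understood after a suitable rearrangement of the symbols $\pm[e_i]$ by a signed permutation $w$ (in particular, any permutation of the indices $1,\dots,5$ is allowed), i.e. $[e_i]$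 may be replaced by $w[e_i]$ throughout. Let $G'\subseteq G$ be any subgroup. **(i)** Suppose that $\alpha$ is of type I. If $s(G')=\mathbb Z/4\mathbb Z$ then $\operatorname{res}^G_{G'}(\alpha)$ is a proper $4$-torsion class. If $s(G')=2\mathbb Z/4\mathbb Z$ then $\operatorname{res}^G_{G'}(\alpha)$ is a nonzero class annihilated by $2$. If $s(G')=0$ then $\operatorname{res}^G_{G'}(\alpha)=0$. **(ii)** Suppose that $\alpha$ is of type II, with the indices normalised as above. If the orbit $\{1\}$ is non-split for $G'$ then $\operatorname{res}^G_{G'}(\alpha)$ is a proper $4$-torsion class. If $\{1\}$ is split for $G'$ and each of the two sets $\{2,4\}$ and $\{3,5\}$ contains at least one $p(G')$-orbit that is non-split for $G'$, then $\operatorname{res}^G_{G'}(\alpha)$ is a nonzero class annihilated by $2$. If $\{1\}$ is split for $G'$ and at least one of the sets $\{2,4\}$ and $\{3,5\}$ consists entirely of split orbits, then $\operatorname{res}^G_{G'}(\alpha)=0$. -/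

import Mathlib

open CategoryTheory

noncomputable section

namespace OpenDP4

/-! ### The groups

The indices `1, …, 5` of the five pairs of systems of conics are written `0, …, 4`. -/

/-- `S₅` acting on sign vectors by permuting the indices. -/
def permSigns : Equiv.Perm (Fin 5) →* MulAut (Fin 5 → ℤˣ) where
  toFun σ :=
    { toFun := fun a i => a (σ.symm i)
      invFun := fun a i => a (σ i)
      left_inv := fun a => by ext i; simp
      right_inv := fun a => by ext i; simp
      map_mul' := fun _ _ => rfl }
  map_one' := rfl
  map_mul' _ _ := rfl

/-- The wreath product `S₂ ≀ S₅ = (ℤ/2)⁵ ⋊ S₅` of signed permutations. The sign group `ℤ/2` is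
written multiplicatively as `ℤˣ = {1, -1}`. -/
abbrev SignedPerm : Type := (Fin 5 → ℤˣ) ⋊[permSigns] Equiv.Perm (Fin 5)

/-- The projection `p` to `S₅`. -/
abbrev p : SignedPerm →* Equiv.Perm (Fin 5) := SemidirectProduct.rightHom

/-- The group `(ℤ/2)⁴ ⋊ S₅ ≅ W(D₅)` of the signed permutations with an even number of sign
changes, as a subgroup of `(ℤ/2)⁵ ⋊ S₅`. -/
def W : Subgroup SignedPerm where
  carrier := {w | ∏ i, w.left i = 1}
  one_mem' := by simp
  mul_mem' := by
    intro a b ha hb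
    simp only [Set.mem_ofPred_eq, SemidirectProduct.mul_left, Pi.mul_apply,
      Finset.prod_mul_distrib] at *
    rw [ha, one_mul, ← hb]
    exact Equiv.prod_comp a.right.symm b.left
  inv_mem' := by
    intro a ha
    simp only [Set.mem_ofPred_eq, SemidirectProduct.inv_left] at *
    have h : ∏ i, (permSigns a.right⁻¹ a.left⁻¹) i = ∏ i, a.left⁻¹ i :=
      Equiv.prod_comp a.right a.left⁻¹
    rw [h]
    simp [ha]

/-! ### The module `𝔓` -/

/-- The lattice `𝔓` generated by `[e₁], …, [e₅]` and `([e₁] + ⋯ + [e₅]) / 2`, inside the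
`ℚ`-vector space with basis `[e₁], …, [e₅]`. -/
def Pic : Submodule ℤ (Fin 5 → ℚ) :=
  Submodule.span ℤ (Set.range (fun i : Fin 5 => (Pi.single i 1 : Fin 5 → ℚ)) ∪ {fun _ => 1 / 2})

/-- The class `[eᵢ]`. -/
def e (i : Fin 5) : Pic := ⟨Pi.single i 1, Submodule.subset_span (Or.inl ⟨i, rfl⟩)⟩

/-- A signed permutation `w = (a, σ)` acts on `ℚ⁵` by `[eᵢ] ↦ a_{σ(i)} [e_{σ(i)}]`. -/
def act : Representation ℤ SignedPerm (Fin 5 → ℚ) where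
  toFun w :=
    { toFun := fun x i => ((w.left i : ℤ) : ℚ) * x (w.right.symm i)
      map_add' := fun x y => by ext i; simp [mul_add]
      map_smul' := fun n x => by ext i; simp; ring }
  map_one' := by
    refine LinearMap.ext fun x => funext fun i => ?_
    change ((1 : ℤ) : ℚ) * x i = x i
    simp
  map_mul' a b := by
    refine LinearMap.ext fun x => funext fun i => ?_
    change (((a.left i * b.left (a.right.symm i) : ℤˣ) : ℤ) : ℚ) *
        x (b.right.symm (a.right.symm i)) =
      ((a.left i : ℤ) : ℚ) * (((b.left (a.right.symm i) : ℤ) : ℚ) *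
        x (b.right.symm (a.right.symm i)))
    push_cast
    ring

theorem act_single (w : SignedPerm) (i : Fin 5) :
    act w (Pi.single i 1) = (w.left (w.right i) : ℤ) • (Pi.single (w.right i) 1 : Fin 5 → ℚ) := by
  ext j
  by_cases h : j = w.right i
  · subst h; simp [act]
  · have h' : w.right.symm j ≠ i := fun hh => h (by simp [← hh])
    simp [act, h, h']

theorem act_mem (w : SignedPerm) {x : Fin 5 → ℚ} (hx : x ∈ Pic) : act w x ∈ Pic := by
  have key : Pic ≤ Pic.comap (act w) := by
    refine Submodule.span_le.2 ?_
    rintro _ (⟨i, rfl⟩ | rfl)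
    · change act w (Pi.single i 1) ∈ Pic
      rw [act_single]
      exact Pic.smul_mem _ (e _).2
    · have half : (fun _ => 1 / 2 : Fin 5 → ℚ) ∈ Pic := Submodule.subset_span (Or.inr rfl)
      have hsum : act w (fun _ => 1 / 2) = (fun _ => 1 / 2) -
          ∑ i, (if w.left i = 1 then (0 : ℤ) else 1) • (Pi.single i 1 : Fin 5 → ℚ) := by
        ext j
        have hs : (∑ i, (if w.left i = 1 then (0 : ℤ) else 1) •
            (Pi.single i 1 : Fin 5 → ℚ)) j = if w.left j = 1 then 0 else 1 := by
          rw [Finset.sum_apply, Finset.sum_eq_single j]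
          · split_ifs <;> simp
          · intro i _ hij
            simp [Pi.single_eq_of_ne (Ne.symm hij)]
          · simp
        rw [Pi.sub_apply, hs]
        rcases Int.units_eq_one_or (w.left j) with h | h <;> simp [act, h]
        norm_num
      change act w (fun _ => 1 / 2) ∈ Pic
      rw [hsum]
      exact Pic.sub_mem half (Pic.sum_mem fun i _ => Pic.smul_mem _ (e i).2)
  exact key hx

/-- The operation of the signed permutations on `𝔓`. -/
def picρ : Representation ℤ SignedPerm Pic where
  toFun w := (act w).restrict fun _ hx => act_mem w hx
  map_one' := by ext x : 2; simp
  map_mul' a b := by ext x : 2; simp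

/-- `𝔓` as a `G`-module, for a subgroup `G` of signed permutations. -/
abbrev picRep (G : Subgroup SignedPerm) : Rep ℤ G := Rep.of (picρ.comp G.subtype)

/-! ### Cohomology -/

/-- The group `H¹(G, 𝔓)`. -/
abbrev H1Pic (G : Subgroup SignedPerm) : ModuleCat ℤ := groupCohomology (picRep G) 1

/-- The restriction map `H¹(G, 𝔓) → H¹(G', 𝔓)`, for `G' ⊆ G`. -/
def res {G G' : Subgroup SignedPerm} (h : G' ≤ G) : H1Pic G ⟶ H1Pic G' :=
  groupCohomology.map (A := picRep G) (B := picRep G') (Subgroup.inclusion h) (𝟙 (picRep G')) 1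

/-- `c ∈ 𝔓` is `G`-invariant modulo `4𝔓`. -/
def InvariantMod4 (G : Subgroup SignedPerm) (c : Pic) : Prop :=
  ∀ g : G, ∃ m : Pic, 4 • m = picρ g c - c

theorem smul_four_injective {x y : Pic} (h : 4 • x = 4 • y) : x = y := by
  ext i
  have := congrFun (congrArg Subtype.val h) i
  simpa using this

/-- For `c` that is `G`-invariant modulo `4𝔓`, the `1`-cocycle `g ↦ (g c - c) / 4`. -/
def iota4Cocycle (G : Subgroup SignedPerm) (c : Pic) (hc : InvariantMod4 G c) :
    groupCohomology.cocycles₁ (picRep G) :=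
  ⟨fun g => (hc g).choose, (groupCohomology.mem_cocycles₁_iff (A := picRep G) _).2 fun g h =>
    smul_four_injective <| by
      have hg : 4 • (hc g).choose = picρ g c - c := (hc g).choose_spec
      have hh : 4 • (hc h).choose = picρ h c - c := (hc h).choose_spec
      have hgh : 4 • (hc (g * h)).choose = picρ (g * h : SignedPerm) c - c :=
        (hc (g * h)).choose_spec
      change 4 • (hc (g * h)).choose = 4 • (picρ g (hc h).choose + (hc g).choose)
      rw [hgh, smul_add, hg, ← map_nsmul, hh, map_sub, map_mul, Module.End.mul_apply]
      abel⟩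

/-- The image `ι_{Pic,4}(c̄)` in `H¹(G, 𝔓)` of the class in `(𝔓/4𝔓)^G` of an element `c` that is
`G`-invariant modulo `4𝔓`, under the boundary homomorphism `H⁰(G, 𝔓/4𝔓) → H¹(G, 𝔓)` associated
with the short exact sequence `0 → 𝔓 → 𝔓 → 𝔓/4𝔓 → 0` given by multiplication by `4`. -/
def iota4 (G : Subgroup SignedPerm) (c : Pic) (hc : InvariantMod4 G c) : H1Pic G :=
  groupCohomology.H1π (picRep G) (iota4Cocycle G c hc)

/-- `iota4` is the connecting homomorphism of the long exact cohomology sequence. -/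
theorem iota4_eq_δ (G : Subgroup SignedPerm) (c : Pic) (hc : InvariantMod4 G c)
    {V : Type} [AddCommGroup V] (ρ : Representation ℤ G V) (q : picRep G ⟶ Rep.of ρ)
    (hq : ((4 : ℤ) • 𝟙 (picRep G)) ≫ q = 0)
    (hX : (ShortComplex.mk ((4 : ℤ) • 𝟙 (picRep G)) q hq).ShortExact)
    (z : ρ.invariants) (hz : q.hom c = z) :
    groupCohomology.δ hX 0 1 rfl ((groupCohomology.H0Iso (Rep.of ρ)).inv z) = iota4 G c hc :=
  groupCohomology.δ₀_apply hX z c hz (iota4Cocycle G c hc).1 <| by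
    funext g
    have h : 4 • (hc g).choose = picρ g c - c := (hc g).choose_spec
    simpa [← natCast_zsmul] using! h

/-- A class that is annihilated by `4`, but not by `2`. -/
def IsProper4Torsion {G : Subgroup SignedPerm} (x : H1Pic G) : Prop :=
  4 • x = 0 ∧ 2 • x ≠ 0

/-- A nonzero class that is annihilated by `2`. -/
def IsNontrivial2Torsion {G : Subgroup SignedPerm} (x : H1Pic G) : Prop :=
  x ≠ 0 ∧ 2 • x = 0

/-! ### Split and non-split orbits -/

/-- `O ⊆ {1, …, 5}` is an orbit of `S = p(G)`. -/
def IsIndexOrbit (G : Subgroup SignedPerm) (O : Set (Fin 5)) : Prop :=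
  ∃ i, O = MulAction.orbit (G.map p) i

/-- The subset `{±[eᵢ] : i ∈ O}` of `𝔓`. -/
def signedClasses (O : Set (Fin 5)) : Set Pic := {x | ∃ i ∈ O, x = e i ∨ x = -e i}

/-- The `G`-orbit of an element of `𝔓`. -/
def picOrbit (G : Subgroup SignedPerm) (x : Pic) : Set Pic := {y | ∃ g ∈ G, picρ g x = y}

/-- The orbit `O` is non-split: `G` acts transitively on `{±[eᵢ] : i ∈ O}`. -/
def IsNonsplit (G : Subgroup SignedPerm) (O : Set (Fin 5)) : Prop :=
  ∀ x ∈ signedClasses O, ∀ y ∈ signedClasses O, y ∈ picOrbit G x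

/-- The orbit `O` is split: `{±[eᵢ] : i ∈ O}` consists of exactly two `G`-orbits. -/
def IsSplit (G : Subgroup SignedPerm) (O : Set (Fin 5)) : Prop :=
  (picOrbit G '' signedClasses O).ncard = 2

/-- `A` contains at least one non-split orbit. -/
def ContainsNonsplitOrbit (G : Subgroup SignedPerm) (A : Set (Fin 5)) : Prop :=
  ∃ O ⊆ A, IsIndexOrbit G O ∧ IsNonsplit G O

/-- Every orbit contained in `A` is split. -/
def AllOrbitsSplit (G : Subgroup SignedPerm) (A : Set (Fin 5)) : Prop :=
  ∀ O ⊆ A, IsIndexOrbit G O → IsSplit G O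

/-! ### Type I -/

/-- The signed permutation `τ : [e₄] ↦ [e₅] ↦ -[e₄]`, `[eᵢ] ↦ -[eᵢ]` for `i = 1, 2, 3`. -/
def τ : SignedPerm := ⟨![-1, -1, -1, -1, 1], Equiv.swap 3 4⟩

/-- `S₃`, permuting the indices `1, 2, 3` and fixing `4` and `5`. -/
abbrev S3 : Subgroup (Equiv.Perm (Fin 5)) := fixingSubgroup (Equiv.Perm (Fin 5)) ({3, 4} : Set (Fin 5))

set_option maxRecDepth 100000 in
theorem S3_commute_τ (σ : S3) (t : Subgroup.zpowers τ) :
    Commute ((SemidirectProduct.inr.comp S3.subtype) σ : SignedPerm)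
      ((Subgroup.zpowers τ).subtype t) := by
  obtain ⟨σ, hσ⟩ := σ
  obtain ⟨_, n, rfl⟩ := t
  refine Commute.zpow_right ?_ n
  have h3 : σ 3 = 3 := (mem_fixingSubgroup_iff _).1 hσ 3 (by simp)
  have h4 : σ 4 = 4 := (mem_fixingSubgroup_iff _).1 hσ 4 (by simp)
  have key : ∀ σ : Equiv.Perm (Fin 5), σ 3 = 3 → σ 4 = 4 →
      (∀ i, τ.left (σ.symm i) = τ.left i) ∧
        ∀ i, σ (Equiv.swap 3 4 i) = Equiv.swap 3 4 (σ i) := by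
    decide
  refine SemidirectProduct.ext ?_ ?_
  · refine funext fun i => ?_
    change 1 * τ.left (σ.symm i) = τ.left i * 1
    rw [one_mul, mul_one, (key σ h3 h4).1 i]
  · exact Equiv.ext fun i => (key σ h3 h4).2 i

/-- The embedding of `S₃ × ⟨τ⟩`, where `⟨τ⟩ ≅ ℤ/4ℤ`, into the group of signed permutations. -/
def embI : S3 × Subgroup.zpowers τ →* SignedPerm :=
  MonoidHom.noncommCoprod (SemidirectProduct.inr.comp S3.subtype) (Subgroup.zpowers τ).subtype
    S3_commute_τ

theorem embI_injective : Function.Injective embI := by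
  rw [embI, MonoidHom.noncommCoprod_injective]
  refine ⟨SemidirectProduct.inr_injective.comp S3.subtype_injective,
    (Subgroup.zpowers τ).subtype_injective, ?_⟩
  rw [Subgroup.disjoint_def]
  rintro _ ⟨⟨σ, hσ⟩, rfl⟩ ⟨⟨t, n, ht⟩, hn⟩
  have h3 : σ 3 = 3 := (mem_fixingSubgroup_iff _).1 hσ 3 (by simp)
  have h4 : (τ : SignedPerm) ^ (4 : ℤ) = 1 := by
    refine SemidirectProduct.ext ?_ ?_ <;> decide
  have hn' : τ ^ (n % 4) = SemidirectProduct.inr σ := by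
    have h : τ ^ n = SemidirectProduct.inr σ := ht.trans hn
    rw [← h]
    conv_rhs => rw [← Int.mul_ediv_add_emod n 4, zpow_add, zpow_mul, h4, one_zpow, one_mul]
  have key : n % 4 = 0 := by
    have hl : (τ ^ (n % 4)).left = 1 := by rw [hn']; rfl
    have hr : (τ ^ (n % 4)).right 3 = 3 := by rw [hn']; exact h3
    have h0 := Int.emod_nonneg n (by norm_num : (4 : ℤ) ≠ 0)
    have h5 := Int.emod_lt_of_pos n (by norm_num : (0 : ℤ) < 4)
    generalize n % 4 = m at *
    interval_cases m <;> revert hl hr <;> decide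
  change (SemidirectProduct.inr σ : SignedPerm) = 1
  rw [← hn', key, zpow_zero]

/-- The embedding of `S₃ × ⟨τ⟩` after the indices `1, …, 5` (and, possibly, some of the signs) have
been rearranged by `w`: the role of `[eᵢ]` is played by `w [eᵢ]`. -/
def embIConj (w : SignedPerm) : S3 × Subgroup.zpowers τ →* SignedPerm :=
  (MulAut.conj w).toMonoidHom.comp embI

theorem embIConj_injective (w : SignedPerm) : Function.Injective (embIConj w) :=
  (MulAut.conj w).injective.comp embI_injective

/-- The projection `s : S₃ × ⟨τ⟩ → ⟨τ⟩`, defined on the image of `S₃ × ⟨τ⟩`. -/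
def sHom (w : SignedPerm) : (embIConj w).range →* Subgroup.zpowers τ :=
  (MonoidHom.snd _ _).comp (MonoidHom.ofInjective (embIConj_injective w)).symm.toMonoidHom

/-- The image `s(G) ⊆ ⟨τ⟩ ≅ ℤ/4ℤ` of a subgroup `G` of `S₃ × ⟨τ⟩`. -/
def sImage (w : SignedPerm) (G : Subgroup SignedPerm) : Subgroup (Subgroup.zpowers τ) :=
  (G.subgroupOf (embIConj w).range).map (sHom w)

/-- `τ` as an element of `⟨τ⟩`. -/
def τGen : Subgroup.zpowers τ := ⟨τ, Subgroup.mem_zpowers τ⟩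

/-- `α ∈ H¹(G, 𝔓)` is the `4`-torsion class of type I with respect to the rearrangement `w`:
`G ⊆ S₃ × ℤ/4ℤ` surjects onto `ℤ/4ℤ`, and `α = ι_{Pic,4}([e₁] + [e₂] + [e₃] + 2[e₄])`. -/
def IsTypeI (w : SignedPerm) (G : Subgroup SignedPerm) (α : H1Pic G) : Prop :=
  G ≤ (embIConj w).range ∧ sImage w G = ⊤ ∧
    ∃ hc : InvariantMod4 G (picρ w (e 0 + e 1 + e 2 + 2 • e 3)), α = iota4 G _ hc

/-! ### Type II -/

/-- The two conditions on a group of type II, for the given numbering of the indices: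
`p(G)` fixes `1` and respects the block system `{{2,4}, {3,5}}`, and `p(σ)` interchanges the two
blocks if and only if `σ[e₁] = -[e₁]`, for `σ ∈ G`. -/
def TypeIICondition (G : Subgroup SignedPerm) : Prop :=
  (∀ σ ∈ G, p σ 0 = 0) ∧
  (∀ σ ∈ G, (p σ '' {1, 3} = {1, 3} ∧ p σ '' {2, 4} = {2, 4}) ∨
    (p σ '' {1, 3} = {2, 4} ∧ p σ '' {2, 4} = {1, 3})) ∧
  (∀ σ ∈ G, (p σ '' {1, 3} = {2, 4} ∧ p σ '' {2, 4} = {1, 3}) ↔ picρ σ (e 0) = -e 0)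

/-- `α ∈ H¹(G, 𝔓)` is the `4`-torsion class of type II with respect to the rearrangement `w`:
`w⁻¹ G w` satisfies the conditions above, `[e₁]` is mapped to `-[e₁]` by some element, and
`α = ι_{Pic,4}([e₁] + 2[e₂] + 2[e₄])`, where the role of `[eᵢ]` is played by `w [eᵢ]`. -/
def IsTypeII (w : SignedPerm) (G : Subgroup SignedPerm) (α : H1Pic G) : Prop :=
  TypeIICondition (G.map (MulAut.conj w⁻¹).toMonoidHom) ∧
    (∃ σ ∈ G, picρ σ (picρ w (e 0)) = -picρ w (e 0)) ∧
    ∃ hc : InvariantMod4 G (picρ w (e 0 + 2 • e 1 + 2 • e 3)), α = iota4 G _ hc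

end OpenDP4

end

/-!
Restriction commutes with `ι₄`, so everything is a question about the classes `ι₄(c)` of the
subgroup `G'`. Since `𝔓` is torsion-free, the long exact sequence says that `k ι₄(c) = 0`, for
`k n = 4`, exactly if `c` is congruent modulo `n𝔓` to a `G'`-invariant element `d` of `𝔓`
(`nsmul_iota4_eq_zero_iff`). So `2 ι₄(c)` is decided by lifts modulo `2`, and `ι₄(c)` by lifts
modulo `4`. Conjugating by `w` (`hasInvariantLift_conj`) reduces to the standard numbering.

Invariant lifts are excluded in coordinates. All coordinates of an element of `𝔓` are congruent
modulo `ℤ` (`pic_coord_sub`), so those of `(d - c) / n` are. On the other hand, `d` has coordinate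
`0` at every index `i` such that some group element maps `[eᵢ]` to `-[eᵢ]`.

* Type I, `s(G') = ℤ/4`: the last two coordinates of `d` are `0`, so that `d ≡ c` modulo `2𝔓` makes
  the first three odd; but an element over `τ` makes their sum `0`.
* Type I, `s(G') = 2ℤ/4`: the last two coordinates of `d` are `0`, whereas those of `c` are `2` and
  `0`; this contradicts `d ≡ c` modulo `4𝔓`. Modulo `2𝔓`, `[e₁] + [e₂] + [e₃]` is a lift.
* Type II, `{1}` non-split: `d` has first coordinate `0`, hence odd other coordinates. An element
  that reverses `[e₁]` permutes the others with an odd number of sign changes, so it changes the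
  sign of their nonzero product.
* Type II, `{1}` split: the two blocks `{2, 4}` and `{3, 5}` are preserved. Non-split orbits in
  both blocks are excluded as in the second case, and `[e₁]` is a lift modulo `2𝔓`. If one block
  has only split orbits, it carries an invariant element `[e_a] ± [e_b]`, from which a lift modulo
  `4𝔓` is built.
-/

open CategoryTheory

namespace OpenDP4

/-! ### Multiples of `ι₄` and invariant lifts -/

theorem InvariantMod4.mono {G G' : Subgroup SignedPerm} (h : G' ≤ G) {c : Pic}
    (hc : InvariantMod4 G c) : InvariantMod4 G' c :=
  fun g => hc ⟨g, h g.2⟩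

theorem iota4Cocycle_spec (G : Subgroup SignedPerm) (c : Pic) (hc : InvariantMod4 G c) (g : G) :
    4 • (iota4Cocycle G c hc).1 g = picρ g c - c :=
  (hc g).choose_spec

theorem res_iota4 {G G' : Subgroup SignedPerm} (h : G' ≤ G) (c : Pic) (hc : InvariantMod4 G c) :
    res h (iota4 G c hc) = iota4 G' c (hc.mono h) := by
  unfold res iota4
  refine (groupCohomology.H1π_comp_map_apply (A := picRep G) (B := picRep G')
    (Subgroup.inclusion h) (𝟙 (picRep G')) (iota4Cocycle G c hc)).trans ?_
  congr 1

/-- `c` is congruent modulo `n𝔓` to a `G`-invariant element of `𝔓`. -/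
def HasInvariantLift (G : Subgroup SignedPerm) (n : ℕ) (c : Pic) : Prop :=
  ∃ m : Pic, ∀ g ∈ G, picρ g (c + n • m) = c + n • m

theorem nsmul_pic_injective {n : ℕ} (hn : n ≠ 0) {x y : Pic} (h : n • x = n • y) : x = y := by
  ext i
  have := congrFun (congrArg Subtype.val h) i
  simpa [hn] using this

/-- This is exactness of the long cohomology sequence at `H⁰(G, 𝔓/4𝔓)`, applied to `k c`, together
with the fact that `𝔓` is torsion-free: if `g m - m = k (g c - c) / 4` for all `g`, then `c - n m`
is invariant. -/
theorem nsmul_iota4_eq_zero_iff (G : Subgroup SignedPerm) (c : Pic) (hc : InvariantMod4 G c)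
    {k n : ℕ} (hkn : k * n = 4) : k • iota4 G c hc = 0 ↔ HasInvariantLift G n c := by
  have hk : k ≠ 0 := by rintro rfl; simp at hkn
  have hn : n ≠ 0 := by rintro rfl; simp at hkn
  have hπ : k • iota4 G c hc = groupCohomology.H1π (picRep G) (k • iota4Cocycle G c hc) :=
    (map_nsmul (groupCohomology.H1π (picRep G)).hom k (iota4Cocycle G c hc)).symm
  rw [hπ, groupCohomology.H1π_eq_zero_iff]
  have key : ∀ (m : Pic) (g : G), picρ g m - m = k • (iota4Cocycle G c hc).1 g ↔
      picρ g (c + n • (-m)) = c + n • (-m) := by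
    intro m g
    have h1 : picρ g m - m = k • (iota4Cocycle G c hc).1 g ↔
        k • n • (picρ g m - m) = k • (picρ g c - c) := by
      rw [← iota4Cocycle_spec G c hc g, smul_smul, hkn, smul_comm k 4 ((iota4Cocycle G c hc).1 g)]
      exact ⟨fun h => by rw [h], smul_four_injective⟩
    have h2 : k • n • (picρ g m - m) = k • (picρ g c - c) ↔ n • (picρ g m - m) = picρ g c - c :=
      ⟨nsmul_pic_injective hk, fun h => by rw [h]⟩
    rw [h1, h2, map_add, map_nsmul, map_neg, ← sub_eq_zero, ← sub_eq_zero (a := _ + _),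
      ← neg_eq_zero]
    have h3 : -(n • (picρ g m - m) - (picρ g c - c)) =
        picρ g c + n • -picρ g m - (c + n • -m) := by
      rw [smul_sub, smul_neg, smul_neg]; abel
    rw [h3]
  constructor
  · rintro ⟨m, hm⟩
    exact ⟨-m, fun g hg => (key m ⟨g, hg⟩).1 (congrFun hm ⟨g, hg⟩)⟩
  · rintro ⟨m, hm⟩
    refine ⟨-m, funext fun g => (key (-m) g).2 ?_⟩
    rw [neg_neg]
    exact hm g g.2

theorem four_nsmul_iota4 (G : Subgroup SignedPerm) (c : Pic) (hc : InvariantMod4 G c) :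
    4 • iota4 G c hc = 0 :=
  (nsmul_iota4_eq_zero_iff G c hc (n := 1) rfl).2 ⟨-c, fun g _ => by simp⟩

/-- The subgroup `w⁻¹ G w`. -/
def conjSubgroup (w : SignedPerm) (G : Subgroup SignedPerm) : Subgroup SignedPerm :=
  G.map (MulAut.conj w⁻¹).toMonoidHom

theorem mem_conjSubgroup {w : SignedPerm} {G : Subgroup SignedPerm} {h : SignedPerm} :
    h ∈ conjSubgroup w G ↔ w * h * w⁻¹ ∈ G := by
  constructor
  · rintro ⟨g, hg, rfl⟩
    simpa [mul_assoc] using hg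
  · intro hg
    exact ⟨_, hg, by simp [mul_assoc]⟩

theorem conj_mem_conjSubgroup {w : SignedPerm} {G : Subgroup SignedPerm} {g : SignedPerm}
    (hg : g ∈ G) : w⁻¹ * g * w ∈ conjSubgroup w G :=
  mem_conjSubgroup.2 (by simpa [mul_assoc] using hg)

theorem picρ_mul (a b : SignedPerm) (x : Pic) : picρ (a * b) x = picρ a (picρ b x) := by
  rw [map_mul, Module.End.mul_apply]

theorem picρ_injective (w : SignedPerm) : Function.Injective (picρ w) := by
  intro x y h
  have := congrArg (picρ w⁻¹) h
  simpa [← picρ_mul] using this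

theorem hasInvariantLift_conj (w : SignedPerm) (G : Subgroup SignedPerm) (n : ℕ) (c : Pic) :
    HasInvariantLift G n (picρ w c) ↔ HasInvariantLift (conjSubgroup w G) n c := by
  constructor
  · rintro ⟨m, hm⟩
    refine ⟨picρ w⁻¹ m, fun h hh => picρ_injective w ?_⟩
    have hw : picρ w (c + n • picρ w⁻¹ m) = picρ w c + n • m := by
      rw [map_add, map_nsmul, ← picρ_mul]; simp
    have := hm _ (mem_conjSubgroup.1 hh)
    rw [← hw, ← picρ_mul] at this
    rw [← this, ← picρ_mul]
    congr 2
    group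
  · rintro ⟨m, hm⟩
    refine ⟨picρ w m, fun g hg => ?_⟩
    have h := congrArg (picρ w) (hm _ (conj_mem_conjSubgroup hg))
    rw [← picρ_mul, ← mul_assoc, mul_inv_cancel_left, picρ_mul] at h
    rw [← map_nsmul, ← map_add, h]

/-! ### Coordinates -/

theorem picρ_apply (h : SignedPerm) (x : Pic) (i : Fin 5) :
    (picρ h x).1 i = ((h.left i : ℤ) : ℚ) * x.1 (h.right.symm i) :=
  rfl

theorem picρ_e (h : SignedPerm) (i : Fin 5) :
    picρ h (e i) = (h.left (h.right i) : ℤ) • e (h.right i) :=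
  Subtype.ext (act_single h i)

theorem coe_e (i : Fin 5) : (e i).1 = Pi.single i 1 := rfl

/-- The coordinates of an element of `𝔓` are all congruent modulo `ℤ`. -/
theorem pic_coord_sub (x : Pic) (i j : Fin 5) : ∃ k : ℤ, x.1 i - x.1 j = k := by
  obtain ⟨x, hx⟩ := x
  change ∃ k : ℤ, x i - x j = k
  induction hx using Submodule.span_induction with
  | mem x hx =>
    rcases hx with ⟨l, rfl⟩ | rfl
    · refine ⟨(Pi.single l 1 : Fin 5 → ℤ) i - (Pi.single l 1 : Fin 5 → ℤ) j, ?_⟩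
      simp [Pi.single_apply]
    · exact ⟨0, by simp⟩
  | zero => exact ⟨0, by simp⟩
  | add x y _ _ hx hy =>
    obtain ⟨a, ha⟩ := hx
    obtain ⟨b, hb⟩ := hy
    refine ⟨a + b, ?_⟩
    push_cast
    rw [← ha, ← hb, Pi.add_apply, Pi.add_apply]
    ring
  | smul n x _ hx =>
    obtain ⟨a, ha⟩ := hx
    refine ⟨n * a, ?_⟩
    push_cast
    rw [← ha, Pi.smul_apply, Pi.smul_apply, zsmul_eq_mul, zsmul_eq_mul]
    ring

/-- The element `([e₁] + ⋯ + [e₅]) / 2`. -/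
def halfSum : Pic := ⟨fun _ => 1 / 2, Submodule.subset_span (Or.inr rfl)⟩

/-- `c = [e₁] + [e₂] + [e₃] + 2[e₄]`, which defines the classes of type I. -/
abbrev cI : Pic := e 0 + e 1 + e 2 + 2 • e 3

/-- `c = [e₁] + 2[e₂] + 2[e₄]`, which defines the classes of type II. -/
abbrev cII : Pic := e 0 + 2 • e 1 + 2 • e 3

theorem coe_cI : cI.1 = ![1, 1, 1, 2, 0] := by
  funext i
  fin_cases i <;> simp [coe_e]

theorem coe_cII : cII.1 = ![1, 2, 0, 2, 0] := by
  funext i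
  fin_cases i <;> simp [coe_e]

/-! ### Type I -/

theorem mem_sImage {w : SignedPerm} {G : Subgroup SignedPerm} {t : Subgroup.zpowers τ} :
    t ∈ sImage w G ↔ ∃ σ : S3, embIConj w (σ, t) ∈ G := by
  have hs : ∀ x (hx : embIConj w x ∈ (embIConj w).range), sHom w ⟨embIConj w x, hx⟩ = x.2 := by
    intro x hx
    change ((MonoidHom.ofInjective (embIConj_injective w)).symm _).2 = x.2
    congr 1
    rw [MulEquiv.symm_apply_eq]
    rfl
  constructor
  · rintro ⟨⟨_, ⟨σ, t'⟩, rfl⟩, hx, rfl⟩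
    exact ⟨σ, (hs (σ, t') _).symm ▸ hx⟩
  · rintro ⟨σ, hσ⟩
    exact ⟨⟨_, (σ, t), rfl⟩, hσ, hs (σ, t) _⟩

theorem embI_mem_conjSubgroup {w : SignedPerm} {G : Subgroup SignedPerm}
    {x : S3 × Subgroup.zpowers τ} : embI x ∈ conjSubgroup w G ↔ embIConj w x ∈ G :=
  mem_conjSubgroup

theorem exists_of_mem_conjSubgroup {w : SignedPerm} {G : Subgroup SignedPerm}
    (hG : G ≤ (embIConj w).range) {h : SignedPerm} (hh : h ∈ conjSubgroup w G) :
    ∃ σ : S3, ∃ t ∈ sImage w G, h = SemidirectProduct.inr σ.1 * t.1 := by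
  obtain ⟨⟨σ, t⟩, hx⟩ := hG (mem_conjSubgroup.1 hh)
  have hx' : embI (σ, t) = h := (MulAut.conj w).injective hx
  refine ⟨σ, t, mem_sImage.2 ⟨σ, embI_mem_conjSubgroup.1 ?_⟩, hx'.symm⟩
  rwa [hx']

theorem S3_symm_apply (σ : S3) : σ.1.symm 3 = 3 ∧ σ.1.symm 4 = 4 :=
  ⟨σ.1.symm_apply_eq.2 ((mem_fixingSubgroup_iff _).1 σ.2 3 (by simp)).symm,
    σ.1.symm_apply_eq.2 ((mem_fixingSubgroup_iff _).1 σ.2 4 (by simp)).symm⟩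

/-- An element whose first three coordinates agree is invariant under `S₃`. -/
theorem picρ_inr_S3 (σ : S3) (x : Pic) (h1 : x.1 1 = x.1 0) (h2 : x.1 2 = x.1 0) :
    picρ (SemidirectProduct.inr σ.1) x = x := by
  ext i
  obtain ⟨h3, h4⟩ := S3_symm_apply σ
  have h012 : ∀ j : Fin 5, j ≠ 3 → j ≠ 4 → x.1 j = x.1 0 := by
    intro j
    fin_cases j <;> simp [h1, h2]
  rw [picρ_apply]
  change ((1 : ℤ) : ℚ) * x.1 (σ.1.symm i) = x.1 i
  rw [Int.cast_one, one_mul]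
  by_cases hi3 : i = 3
  · rw [hi3, h3]
  by_cases hi4 : i = 4
  · rw [hi4, h4]
  rw [h012 i hi3 hi4, h012]
  · exact fun h => hi3 (σ.1.symm.injective (h.trans h3.symm))
  · exact fun h => hi4 (σ.1.symm.injective (h.trans h4.symm))

theorem τ_sq : τ ^ 2 = ⟨![1, 1, 1, -1, -1], 1⟩ := by
  refine SemidirectProduct.ext ?_ ?_ <;> decide

/-- An element with `[e₄]`- and `[e₅]`-coordinate `0` is invariant under `τ²`. -/
theorem picρ_zpowers_τ_sq (x : Pic) (h3 : x.1 3 = 0) (h4 : x.1 4 = 0)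
    {t : Subgroup.zpowers τ} (ht : t ∈ Subgroup.zpowers (τGen ^ 2)) : picρ t.1 x = x := by
  have hsq : picρ (τ ^ 2) x = x := by
    ext i
    have h1 : (1 : Equiv.Perm (Fin 5)).symm = 1 := rfl
    rw [picρ_apply, τ_sq]
    fin_cases i <;> simp [h1, h3, h4]
  obtain ⟨n, rfl⟩ := ht
  have hn : (((τGen ^ 2) ^ n : Subgroup.zpowers τ) : SignedPerm) = (τ ^ 2) ^ n := rfl
  change picρ (((τGen ^ 2) ^ n : Subgroup.zpowers τ) : SignedPerm) x = x
  rw [hn]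
  induction n using Int.induction_on with
  | zero => simp
  | succ k ih => rw [zpow_add_one, picρ_mul, hsq]; exact ih rfl
  | pred k ih =>
    rw [zpow_sub_one, picρ_mul]
    nth_rewrite 1 [← hsq]
    rw [← picρ_mul _ (τ ^ 2), inv_mul_cancel, map_one]
    exact ih rfl

theorem coord_eq_of_picρ_inr_mul {σ : S3} {t : SignedPerm} {d : Pic}
    (hd : picρ (SemidirectProduct.inr σ.1 * t) d = d) (i : Fin 5) :
    d.1 i = ((t.left (σ.1.symm i) : ℤ) : ℚ) * d.1 (t.right.symm (σ.1.symm i)) := by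
  have h := congrArg (fun y : Pic => y.1 i) hd
  simp only [picρ_mul] at h
  rw [picρ_apply, picρ_apply] at h
  rw [← h]
  change ((1 : ℤ) : ℚ) * _ = _
  rw [Int.cast_one, one_mul]
  rfl

/-- If `s(G)` is everything, some `(σ, τ) ∈ G` forces an invariant element to have vanishing
`[e₄]`- and `[e₅]`-coordinate, and first three coordinates of sum `0`. An element congruent to `c`
modulo `2𝔓` with the former property has odd first three coordinates. -/
theorem not_hasInvariantLift_cI_two {w : SignedPerm} {G : Subgroup SignedPerm}
    (hs : sImage w G = ⊤) : ¬ HasInvariantLift (conjSubgroup w G) 2 cI := by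
  rintro ⟨m, hm⟩
  obtain ⟨σ, hσ⟩ := mem_sImage.1 (hs ▸ Subgroup.mem_top τGen)
  have hd := coord_eq_of_picρ_inr_mul (σ := σ) (t := τ) (hm _ (embI_mem_conjSubgroup.2 hσ))
  obtain ⟨s3, s4⟩ := S3_symm_apply σ
  have c := congrFun coe_cI
  generalize hdd : cI + 2 • m = d at hd
  have hdm : ∀ i, d.1 i = cI.1 i + 2 * m.1 i := by
    intro i
    rw [← hdd]
    simp
  have e3 : d.1 3 = -d.1 4 := by
    rw [hd 3, s3]
    simp [τ]
  have e4 : d.1 4 = d.1 3 := by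
    rw [hd 4, s4]
    simp [τ]
  have hsum : ∑ i, d.1 i = ∑ j, (((τ.left j : ℤ) : ℚ) * d.1 (Equiv.swap 3 4 j)) :=
    (Finset.sum_congr rfl fun i _ => hd i).trans
      (Equiv.sum_comp σ.1.symm fun j => ((τ.left j : ℤ) : ℚ) * d.1 (Equiv.swap 3 4 j))
  have w0 : Equiv.swap (3 : Fin 5) 4 0 = 0 := by decide
  have w1 : Equiv.swap (3 : Fin 5) 4 1 = 1 := by decide
  have w2 : Equiv.swap (3 : Fin 5) 4 2 = 2 := by decide
  simp only [Fin.sum_univ_five, τ, w0, w1, w2, Equiv.swap_apply_left,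
    Equiv.swap_apply_right] at hsum
  simp at hsum
  obtain ⟨k0, hk0⟩ := pic_coord_sub m 0 4
  obtain ⟨k1, hk1⟩ := pic_coord_sub m 1 4
  obtain ⟨k2, hk2⟩ := pic_coord_sub m 2 4
  have g0 := hdm 0
  have g1 := hdm 1
  have g2 := hdm 2
  have g4 := hdm 4
  simp only [c] at g0 g1 g2 g4
  simp at g0 g1 g2 g4
  have : (3 + 2 * (k0 + k1 + k2) : ℚ) = 0 := by linarith
  have : 3 + 2 * (k0 + k1 + k2) = 0 := by exact_mod_cast this
  omega

/-- If `s(G)` contains `τ²`, an invariant element has vanishing `[e₄]`- and `[e₅]`-coordinate. -/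
theorem not_hasInvariantLift_cI_four {w : SignedPerm} {G : Subgroup SignedPerm}
    (hs : τGen ^ 2 ∈ sImage w G) : ¬ HasInvariantLift (conjSubgroup w G) 4 cI := by
  rintro ⟨m, hm⟩
  obtain ⟨σ, hσ⟩ := mem_sImage.1 hs
  have hd := coord_eq_of_picρ_inr_mul (σ := σ) (t := τ ^ 2) (hm _ (embI_mem_conjSubgroup.2 hσ))
  obtain ⟨s3, s4⟩ := S3_symm_apply σ
  have h1 : (1 : Equiv.Perm (Fin 5)).symm = 1 := rfl
  have e3 := hd 3
  have e4 := hd 4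
  rw [τ_sq, s3] at e3
  rw [τ_sq, s4] at e4
  have hc : ∀ i, (cI + 4 • m).1 i = cI.1 i + 4 * m.1 i := by
    intro i
    simp
  simp only [hc, coe_cI] at e3 e4
  simp [h1] at e3 e4
  obtain ⟨k, hk⟩ := pic_coord_sub m 4 3
  have : (2 * k : ℚ) = 1 := by linarith
  have : 2 * k = 1 := by exact_mod_cast this
  omega

theorem hasInvariantLift_cI_two {w : SignedPerm} {G : Subgroup SignedPerm}
    (hG : G ≤ (embIConj w).range) (hs : sImage w G = Subgroup.zpowers (τGen ^ 2)) :
    HasInvariantLift (conjSubgroup w G) 2 cI := by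
  refine ⟨-e 3, fun h hh => ?_⟩
  obtain ⟨σ, t, ht, rfl⟩ := exists_of_mem_conjSubgroup hG hh
  rw [picρ_mul, picρ_zpowers_τ_sq _ ?_ ?_ (hs ▸ ht), picρ_inr_S3 _ _ ?_ ?_] <;>
    simp [coe_e]

theorem hasInvariantLift_cI_four {w : SignedPerm} {G : Subgroup SignedPerm}
    (hG : G ≤ (embIConj w).range) (hs : sImage w G = ⊥) :
    HasInvariantLift (conjSubgroup w G) 4 cI := by
  refine ⟨0, fun h hh => ?_⟩
  obtain ⟨σ, t, ht, rfl⟩ := exists_of_mem_conjSubgroup hG hh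
  rw [hs, Subgroup.mem_bot] at ht
  rw [picρ_mul, ht, Subgroup.coe_one, map_one, Module.End.one_apply, picρ_inr_S3] <;>
    simp [coe_e]

/-! ### Sign reversals and orbits -/

/-- Some element of `G` maps `[eᵢ]` to `-[eᵢ]`. -/
def Reverses (G : Subgroup SignedPerm) (i : Fin 5) : Prop := ∃ g ∈ G, picρ g (e i) = -e i

theorem picρ_e_eq_neg_iff {h : SignedPerm} {i : Fin 5} :
    picρ h (e i) = -e i ↔ h.right i = i ∧ h.left i = -1 := by
  rw [picρ_e]
  constructor
  · intro H
    have hi := congrArg (fun y : Pic => y.1 i) H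
    by_cases hr : h.right i = i
    · refine ⟨hr, ?_⟩
      rcases Int.units_eq_one_or (h.left i) with hl | hl
      · rw [hr, hl] at hi
        norm_num [coe_e] at hi
      · exact hl
    · simp [coe_e, Ne.symm hr] at hi
  · rintro ⟨hr, hl⟩
    rw [hr, hl]
    simp

theorem Reverses.coord_eq_zero {G : Subgroup SignedPerm} {i : Fin 5} (hi : Reverses G i) {d : Pic}
    (hd : ∀ g ∈ G, picρ g d = d) : d.1 i = 0 := by
  obtain ⟨g, hg, hgi⟩ := hi
  obtain ⟨hr, hl⟩ := picρ_e_eq_neg_iff.1 hgi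
  have h := congrArg (fun y : Pic => y.1 i) (hd g hg)
  have hr' : g.right.symm i = i := g.right.symm_apply_eq.2 hr.symm
  simp only [picρ_apply, hr', hl] at h
  push_cast at h
  linarith

theorem left_eq_one_of_not_reverses {G : Subgroup SignedPerm} {i : Fin 5} (hi : ¬ Reverses G i)
    {g : SignedPerm} (hg : g ∈ G) (hr : g.right i = i) : g.left i = 1 :=
  (Int.units_eq_one_or _).resolve_right fun hl => hi ⟨g, hg, picρ_e_eq_neg_iff.2 ⟨hr, hl⟩⟩

theorem reverses_conjSubgroup {w : SignedPerm} {G : Subgroup SignedPerm} {i : Fin 5} :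
    Reverses (conjSubgroup w G) i ↔ Reverses G (p w i) := by
  have hw : ∀ g : SignedPerm, picρ g (e (p w i)) = -e (p w i) ↔
      picρ g (picρ w (e i)) = -picρ w (e i) := by
    intro g
    rw [picρ_e w i]
    change _ ↔ picρ g ((w.left (p w i) : ℤ) • e (p w i)) = -((w.left (p w i) : ℤ) • e (p w i))
    rcases Int.units_eq_one_or (w.left (p w i)) with hl | hl <;> rw [hl] <;>
      simp [neg_eq_iff_eq_neg]
  constructor
  · rintro ⟨h, hh, hi⟩
    refine ⟨_, mem_conjSubgroup.1 hh, (hw _).2 ?_⟩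
    rw [← picρ_mul, inv_mul_cancel_right, picρ_mul, hi, map_neg]
  · rintro ⟨g, hg, hi⟩
    refine ⟨_, conj_mem_conjSubgroup hg, picρ_injective w ?_⟩
    rw [← picρ_mul, map_neg, ← (hw g).1 hi, ← picρ_mul, ← mul_assoc, mul_inv_cancel_left]

theorem IsNonsplit.reverses {G : Subgroup SignedPerm} {O : Set (Fin 5)} (hO : IsNonsplit G O)
    {i : Fin 5} (hi : i ∈ O) : Reverses G i :=
  hO (e i) ⟨i, hi, Or.inl rfl⟩ (-e i) ⟨i, hi, Or.inr rfl⟩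

/-- If `G` contains a reversal of `[eᵢ]`, then the elements `±[eⱼ]`, for `j` in the orbit of `i`,
form a single orbit. -/
theorem IsSplit.not_reverses {G : Subgroup SignedPerm} {O : Set (Fin 5)} (hO : IsSplit G O)
    {i : Fin 5} (hsub : ∀ j ∈ O, ∃ g ∈ G, p g i = j) : ¬ Reverses G i := by
  rintro ⟨r, hr, hri⟩
  have key : ∀ x ∈ signedClasses O, ∃ g ∈ G, picρ g (e i) = x := by
    rintro x ⟨j, hj, hx⟩
    obtain ⟨g, hg, rfl⟩ := hsub j hj
    have hge : picρ g (e i) = (g.left (p g i) : ℤ) • e (p g i) := picρ_e g i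
    have hgr : picρ (g * r) (e i) = -((g.left (p g i) : ℤ) • e (p g i)) := by
      rw [picρ_mul, hri, map_neg, hge]
    rcases Int.units_eq_one_or (g.left (p g i)) with hl | hl <;>
      rw [hl] at hge hgr <;> rcases hx with rfl | rfl
    · exact ⟨g, hg, by simpa using hge⟩
    · exact ⟨_, G.mul_mem hg hr, by simpa using hgr⟩
    · exact ⟨_, G.mul_mem hg hr, by simpa using hgr⟩
    · exact ⟨g, hg, by simpa using hge⟩
  have himg : picOrbit G '' signedClasses O ⊆ {picOrbit G (e i)} := by
    rintro _ ⟨x, hx, rfl⟩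
    obtain ⟨g, hg, rfl⟩ := key x hx
    refine Set.ext fun y => ⟨?_, ?_⟩
    · rintro ⟨k, hk, rfl⟩
      exact ⟨k * g, G.mul_mem hk hg, picρ_mul k g _⟩
    · rintro ⟨k, hk, rfl⟩
      refine ⟨k * g⁻¹, G.mul_mem hk (G.inv_mem hg), ?_⟩
      rw [← picρ_mul, inv_mul_cancel_right]
  have hcard := Set.ncard_le_ncard himg
  rw [Set.ncard_singleton, show _ = 2 from hO] at hcard
  omega

theorem p_conj_apply (w g : SignedPerm) (i : Fin 5) : p w (p (w⁻¹ * g * w) i) = p g (p w i) := by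
  rw [← Equiv.Perm.mul_apply, ← Equiv.Perm.mul_apply, ← map_mul, ← map_mul, ← mul_assoc,
    mul_inv_cancel_left]

theorem mem_orbit_map_p {G : Subgroup SignedPerm} {i j : Fin 5} :
    j ∈ MulAction.orbit (G.map p) i ↔ ∃ g ∈ G, p g i = j := by
  constructor
  · rintro ⟨⟨_, g, hg, rfl⟩, rfl⟩
    exact ⟨g, hg, rfl⟩
  · rintro ⟨g, hg, rfl⟩
    exact ⟨⟨p g, g, hg, rfl⟩, rfl⟩

theorem AllOrbitsSplit.not_reverses {w : SignedPerm} {G : Subgroup SignedPerm} {B : Set (Fin 5)}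
    (hsplit : AllOrbitsSplit G (p w '' B)) (hB : ∀ h ∈ conjSubgroup w G, ∀ i ∈ B, p h i ∈ B)
    {i : Fin 5} (hi : i ∈ B) : ¬ Reverses (conjSubgroup w G) i := by
  rw [reverses_conjSubgroup]
  refine (hsplit (MulAction.orbit (G.map p) (p w i)) ?_ ⟨_, rfl⟩).not_reverses
    fun j hj => mem_orbit_map_p.1 hj
  intro j hj
  obtain ⟨g, hg, rfl⟩ := mem_orbit_map_p.1 hj
  exact ⟨_, hB _ (conj_mem_conjSubgroup hg) i hi, p_conj_apply w g i⟩

theorem ContainsNonsplitOrbit.exists_reverses {w : SignedPerm} {G : Subgroup SignedPerm}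
    {B : Set (Fin 5)} (h : ContainsNonsplitOrbit G (p w '' B)) :
    ∃ i ∈ B, Reverses (conjSubgroup w G) i := by
  obtain ⟨O, hOB, ⟨j, rfl⟩, hO⟩ := h
  have hj := MulAction.mem_orbit_self (M := G.map p) j
  obtain ⟨i, hi, rfl⟩ := hOB hj
  exact ⟨i, hi, reverses_conjSubgroup.2 (hO.reverses hj)⟩

/-- A block `{a, b}` all of whose orbits are split carries an invariant element `[e_a] ± [e_b]`: if
some `g` maps `[e_a]` to `ε[e_b]`, take the sign `ε`. -/
theorem exists_invariant_of_not_reverses {G : Subgroup SignedPerm} {a b : Fin 5} (hab : a ≠ b)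
    (hB : ∀ g ∈ G, ∀ i ∈ ({a, b} : Set (Fin 5)), p g i ∈ ({a, b} : Set (Fin 5)))
    (ha : ¬ Reverses G a) (hb : ¬ Reverses G b) :
    ∃ ε : ℤˣ, ∀ g ∈ G, picρ g (e a + (ε : ℤ) • e b) = e a + (ε : ℤ) • e b := by
  have hBa : ∀ g ∈ G, g.right a = a ∨ g.right a = b := fun g hg => hB g hg a (by simp)
  have hBb : ∀ g ∈ G, g.right b = a ∨ g.right b = b := fun g hg => hB g hg b (by simp)
  have fix : ∀ (ε : ℤˣ), ∀ g ∈ G, g.right a = a →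
      picρ g (e a + (ε : ℤ) • e b) = e a + (ε : ℤ) • e b := by
    intro ε g hg hga
    have hgb : g.right b = b :=
      (hBb g hg).resolve_left fun h => hab (g.right.injective (hga.trans h.symm))
    rw [map_add, map_zsmul, picρ_e, picρ_e, hga, hgb, left_eq_one_of_not_reverses ha hg hga,
      left_eq_one_of_not_reverses hb hg hgb]
    simp
  by_cases h0 : ∃ g ∈ G, g.right a = b
  · obtain ⟨g, hg, hgab⟩ := h0
    refine ⟨g.left b, fun h hh => ?_⟩
    have swap : ∀ k ∈ G, k.right a = b → k.right b = a := fun k hk hkab =>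
      (hBb k hk).resolve_right fun h => hab (k.right.injective (hkab.trans h.symm))
    rcases hBa h hh with hha | hhab
    · exact fix _ h hh hha
    · have hgba := swap g hg hgab
      have hhba := swap h hh hhab
      -- Both `g²` and `h g` fix the index `a`, hence fix `[e_a]`.
      have sign : ∀ k ∈ G, k.right b = a → k.left a * g.left b = 1 := by
        intro k hk hkba
        have hr : (k * g).right a = a := by
          rw [SemidirectProduct.mul_right, Equiv.Perm.mul_apply, hgab, hkba]
        have hl := left_eq_one_of_not_reverses ha (G.mul_mem hk hg) hr
        rw [SemidirectProduct.mul_left, Pi.mul_apply] at hl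
        change k.left a * g.left (k.right.symm a) = 1 at hl
        rwa [k.right.symm_apply_eq.2 hkba.symm] at hl
      have sign' : h.left b * g.left a = 1 := by
        have hr : (h * g).right b = b := by
          rw [SemidirectProduct.mul_right, Equiv.Perm.mul_apply, hgba, hhab]
        have hl := left_eq_one_of_not_reverses hb (G.mul_mem hh hg) hr
        rw [SemidirectProduct.mul_left, Pi.mul_apply] at hl
        change h.left b * g.left (h.right.symm b) = 1 at hl
        rwa [h.right.symm_apply_eq.2 hhab.symm] at hl
      have e1 := sign g hg hgba
      have e2 := sign h hh hhba
      rw [map_add, map_zsmul, picρ_e, picρ_e, hhab, hhba]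
      rcases Int.units_eq_one_or (g.left a) with h1 | h1 <;>
        rcases Int.units_eq_one_or (g.left b) with h2 | h2 <;>
        rcases Int.units_eq_one_or (h.left a) with h3 | h3 <;>
        rcases Int.units_eq_one_or (h.left b) with h4 | h4 <;>
        simp [h1, h2, h3, h4] at e1 e2 sign' ⊢ <;> abel
  · exact ⟨1, fun h hh => fix 1 h hh ((hBa h hh).resolve_right fun hb' => h0 ⟨h, hh, hb'⟩)⟩

/-! ### Type II -/

theorem prod_left_mul (a b : SignedPerm) :
    ∏ i, (a * b).left i = (∏ i, a.left i) * ∏ i, b.left i := by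
  rw [SemidirectProduct.mul_left]
  simp only [Pi.mul_apply, Finset.prod_mul_distrib]
  congr 1
  exact Equiv.prod_comp a.right.symm b.left

theorem conjSubgroup_le_W {w : SignedPerm} {G : Subgroup SignedPerm} (hG : G ≤ W) :
    conjSubgroup w G ≤ W := by
  intro h hh
  have hW : ∏ i, (w * h * w⁻¹).left i = 1 := hG (mem_conjSubgroup.1 hh)
  have h1 : (∏ i, w.left i) * ∏ i, w⁻¹.left i = 1 := by
    rw [← prod_left_mul, mul_inv_cancel]
    simp
  rw [prod_left_mul, prod_left_mul, mul_right_comm, h1, one_mul] at hW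
  exact hW

theorem TypeIICondition.mono {G G' : Subgroup SignedPerm} (h : G' ≤ G) (hG : TypeIICondition G) :
    TypeIICondition G' :=
  ⟨fun σ hσ => hG.1 σ (h hσ), fun σ hσ => hG.2.1 σ (h hσ), fun σ hσ => hG.2.2 σ (h hσ)⟩

/-- If `{1}` is split, the two blocks are not interchanged. -/
theorem TypeIICondition.preserves_blocks {G : Subgroup SignedPerm} (hG : TypeIICondition G)
    (h0 : ¬ Reverses G 0) : (∀ g ∈ G, ∀ i ∈ ({1, 3} : Set (Fin 5)), p g i ∈ ({1, 3} : Set (Fin 5))) ∧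
      ∀ g ∈ G, ∀ i ∈ ({2, 4} : Set (Fin 5)), p g i ∈ ({2, 4} : Set (Fin 5)) := by
  have key : ∀ g ∈ G, p g '' {1, 3} = {1, 3} ∧ p g '' {2, 4} = {2, 4} := fun g hg =>
    (hG.2.1 g hg).resolve_right fun h => h0 ⟨g, hg, (hG.2.2 g hg).1 h⟩
  exact ⟨fun g hg i hi => (key g hg).1 ▸ Set.mem_image_of_mem _ hi,
    fun g hg i hi => (key g hg).2 ▸ Set.mem_image_of_mem _ hi⟩

theorem TypeIICondition.picρ_e_zero {G : Subgroup SignedPerm} (hG : TypeIICondition G)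
    (h0 : ¬ Reverses G 0) {g : SignedPerm} (hg : g ∈ G) : picρ g (e 0) = e 0 := by
  have hr : g.right 0 = 0 := hG.1 g hg
  rw [picρ_e, hr, left_eq_one_of_not_reverses h0 hg hr]
  simp

theorem coe_add_nsmul (c m : Pic) (n : ℕ) (i : Fin 5) : (c + n • m).1 i = c.1 i + n * m.1 i := by
  simp

/-- An element congruent to `c` modulo `2𝔓` with vanishing `[e₁]`-coordinate has odd, hence
nonzero, other coordinates. A signed permutation that maps `[e₁]` to `-[e₁]` and has an even number
of sign changes changes the sign of the product of these other coordinates. -/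
theorem not_hasInvariantLift_cII_two {G : Subgroup SignedPerm} (hG : G ≤ W) (h0 : Reverses G 0) :
    ¬ HasInvariantLift G 2 cII := by
  rintro ⟨m, hm⟩
  have hd0 := h0.coord_eq_zero hm
  have hc := coe_add_nsmul cII m 2
  obtain ⟨g, hg, hg0⟩ := h0
  obtain ⟨hr, hl⟩ := picρ_e_eq_neg_iff.1 hg0
  have hd := hm g hg
  rw [coe_cII] at hc
  generalize cII + 2 • m = d at hc hd hd0
  have hm0 := hc 0
  rw [hd0] at hm0
  simp at hm0
  have hne : ∀ i, i ≠ 0 → d.1 i ≠ 0 := by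
    have hv : ∀ i : Fin 5, i ≠ 0 → ∃ a : ℤ, (![1, 2, 0, 2, 0] : Fin 5 → ℚ) i = 2 * a := by
      intro i hi
      fin_cases i
      · exact absurd rfl hi
      · exact ⟨1, by simp⟩
      · exact ⟨0, by simp⟩
      · exact ⟨1, by simp⟩
      · exact ⟨0, by simp⟩
    intro i hi hdi
    obtain ⟨a, ha⟩ := hv i hi
    obtain ⟨k, hk⟩ := pic_coord_sub m i 0
    have hi' := hc i
    rw [hdi, ha] at hi'
    push_cast at hi'
    have : (2 * (a + k) : ℚ) = 1 := by linarith
    have : 2 * (a + k) = 1 := by exact_mod_cast this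
    omega
  have hprod : ∏ i ∈ Finset.univ.erase 0, d.1 i = -∏ i ∈ Finset.univ.erase 0, d.1 i := by
    have h1 : ∏ i ∈ Finset.univ.erase (0 : Fin 5), d.1 i =
        ∏ i ∈ Finset.univ.erase (0 : Fin 5), (((g.left i : ℤ) : ℚ) * d.1 (g.right.symm i)) :=
      Finset.prod_congr rfl fun i _ => (congrArg (fun y : Pic => y.1 i) hd).symm
    have h2 : ∏ i ∈ Finset.univ.erase (0 : Fin 5), d.1 (g.right.symm i) =
        ∏ i ∈ Finset.univ.erase (0 : Fin 5), d.1 i := by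
      refine Finset.prod_equiv g.right.symm (fun i => ?_) fun _ _ => rfl
      simp [g.right.symm_apply_eq, hr]
    have h3 : ∏ i ∈ Finset.univ.erase (0 : Fin 5), g.left i = -1 := by
      have hW : ∏ i, g.left i = 1 := hG hg
      rw [← Finset.mul_prod_erase _ _ (Finset.mem_univ 0), hl] at hW
      rw [← neg_eq_iff_eq_neg, ← neg_one_mul, hW]
    have h4 : ∏ i ∈ Finset.univ.erase (0 : Fin 5), ((g.left i : ℤ) : ℚ) = -1 := by
      rw [← Int.cast_prod, ← Units.coe_prod, h3]
      simp
    rw [Finset.prod_mul_distrib, h2, h4, neg_one_mul] at h1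
    exact h1
  have hz : ∏ i ∈ Finset.univ.erase 0, d.1 i = 0 := by linarith
  obtain ⟨i, hi, hdi⟩ := Finset.prod_eq_zero_iff.1 hz
  exact hne i (Finset.ne_of_mem_erase hi) hdi

/-- A reversal in each block makes the coordinates of an invariant element vanish at some `i` in the
first block and some `j` in the second block, where `c` has coordinates `2` and `0`. -/
theorem not_hasInvariantLift_cII_four {G : Subgroup SignedPerm}
    (h1 : ∃ i ∈ ({1, 3} : Set (Fin 5)), Reverses G i)
    (h2 : ∃ i ∈ ({2, 4} : Set (Fin 5)), Reverses G i) : ¬ HasInvariantLift G 4 cII := by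
  rintro ⟨m, hm⟩
  obtain ⟨i, hi, hri⟩ := h1
  obtain ⟨j, hj, hrj⟩ := h2
  have hdi := hri.coord_eq_zero hm
  have hdj := hrj.coord_eq_zero hm
  rw [coe_add_nsmul, coe_cII] at hdi hdj
  have hci : (![1, 2, 0, 2, 0] : Fin 5 → ℚ) i = 2 := by rcases hi with rfl | rfl <;> rfl
  have hcj : (![1, 2, 0, 2, 0] : Fin 5 → ℚ) j = 0 := by rcases hj with rfl | rfl <;> rfl
  obtain ⟨k, hk⟩ := pic_coord_sub m j i
  rw [hci] at hdi
  rw [hcj] at hdj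
  push_cast at hdi hdj
  have : (2 * k : ℚ) = 1 := by linarith
  have : 2 * k = 1 := by exact_mod_cast this
  omega

theorem hasInvariantLift_cII_two {G : Subgroup SignedPerm} (hG : TypeIICondition G)
    (h0 : ¬ Reverses G 0) : HasInvariantLift G 2 cII := by
  refine ⟨-e 1 - e 3, fun g hg => ?_⟩
  have h : cII + 2 • (-e 1 - e 3) = e 0 := by
    unfold cII
    abel
  rw [h, hG.picρ_e_zero h0 hg]

/-- With an invariant element `[e₂] ± [e₄]`, the lift is `[e₁] + 2([e₂] ± [e₄])`. -/
theorem hasInvariantLift_cII_four_of_first {G : Subgroup SignedPerm} (hG : TypeIICondition G)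
    (h0 : ¬ Reverses G 0) (h1 : ¬ Reverses G 1) (h3 : ¬ Reverses G 3) :
    HasInvariantLift G 4 cII := by
  obtain ⟨ε, hε⟩ := exists_invariant_of_not_reverses (by decide) (hG.preserves_blocks h0).1 h1 h3
  have key : ∃ m : Pic, cII + 4 • m = e 0 + 2 • (e 1 + (ε : ℤ) • e 3) := by
    rcases Int.units_eq_one_or ε with rfl | rfl
    · exact ⟨0, by simp [smul_add, add_assoc]⟩
    · refine ⟨-e 3, ?_⟩
      push_cast
      unfold cII
      abel
  obtain ⟨m, hm⟩ := key
  refine ⟨m, fun g hg => ?_⟩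
  rw [hm, map_add, map_nsmul, hε g hg, hG.picρ_e_zero h0 hg]

/-- With an invariant element `[e₃] ± [e₅]`, the lift is `-[e₁] + 2([e₃] ± [e₅])`, which is congruent
to `c` modulo `4𝔓` because `2([e₁] + ⋯ + [e₅]) ∈ 4𝔓`. -/
theorem hasInvariantLift_cII_four_of_second {G : Subgroup SignedPerm} (hG : TypeIICondition G)
    (h0 : ¬ Reverses G 0) (h2 : ¬ Reverses G 2) (h4 : ¬ Reverses G 4) :
    HasInvariantLift G 4 cII := by
  obtain ⟨ε, hε⟩ := exists_invariant_of_not_reverses (by decide) (hG.preserves_blocks h0).2 h2 h4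
  have key : ∃ m : Pic, cII + 4 • m = -e 0 + 2 • (e 2 + (ε : ℤ) • e 4) := by
    rcases Int.units_eq_one_or ε with rfl | rfl
    · refine ⟨-halfSum + e 2 + e 4, Subtype.ext (funext fun i => ?_)⟩
      fin_cases i <;> simp [halfSum, coe_e] <;> norm_num
    · refine ⟨-halfSum + e 2, Subtype.ext (funext fun i => ?_)⟩
      fin_cases i <;> simp [halfSum, coe_e] <;> norm_num
  obtain ⟨m, hm⟩ := key
  refine ⟨m, fun g hg => ?_⟩
  rw [hm, map_add, map_neg, map_nsmul, hε g hg, hG.picρ_e_zero h0 hg]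

end OpenDP4

/-! ### Restrictions of the 4-torsion classes -/

theorem mainTheorem9
    (G G' : Subgroup OpenDP4.SignedPerm) (hG : G ≤ OpenDP4.W) (hG' : G' ≤ G)
    (α : OpenDP4.H1Pic G) (w : OpenDP4.SignedPerm) :
    (OpenDP4.IsTypeI w G α →
      (OpenDP4.sImage w G' = ⊤ → OpenDP4.IsProper4Torsion (OpenDP4.res hG' α)) ∧
      (OpenDP4.sImage w G' = Subgroup.zpowers (OpenDP4.τGen ^ 2) →
        OpenDP4.IsNontrivial2Torsion (OpenDP4.res hG' α)) ∧
      (OpenDP4.sImage w G' = ⊥ → OpenDP4.res hG' α = 0)) ∧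
    (OpenDP4.IsTypeII w G α →
      (OpenDP4.IsNonsplit G' (OpenDP4.p w '' {0}) →
        OpenDP4.IsProper4Torsion (OpenDP4.res hG' α)) ∧
      (OpenDP4.IsSplit G' (OpenDP4.p w '' {0}) →
        OpenDP4.ContainsNonsplitOrbit G' (OpenDP4.p w '' {1, 3}) →
        OpenDP4.ContainsNonsplitOrbit G' (OpenDP4.p w '' {2, 4}) →
        OpenDP4.IsNontrivial2Torsion (OpenDP4.res hG' α)) ∧
      (OpenDP4.IsSplit G' (OpenDP4.p w '' {0}) →
        (OpenDP4.AllOrbitsSplit G' (OpenDP4.p w '' {1, 3}) ∨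
          OpenDP4.AllOrbitsSplit G' (OpenDP4.p w '' {2, 4})) →
        OpenDP4.res hG' α = 0)) := by
  open OpenDP4 in
  have two : ∀ c hc, 2 • iota4 G' (picρ w c) hc = 0 ↔
      HasInvariantLift (conjSubgroup w G') 2 c := fun c hc =>
    (nsmul_iota4_eq_zero_iff G' _ hc rfl).trans (hasInvariantLift_conj w G' 2 c)
  open OpenDP4 in
  have one : ∀ c hc, iota4 G' (picρ w c) hc = 0 ↔
      HasInvariantLift (conjSubgroup w G') 4 c := fun c hc => by
    rw [← hasInvariantLift_conj, ← nsmul_iota4_eq_zero_iff G' _ hc (k := 1) rfl, one_smul]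
  open OpenDP4 in
  constructor
  · rintro ⟨hr, -, hc, rfl⟩
    rw [res_iota4]
    refine ⟨fun hs => ⟨four_nsmul_iota4 _ _ _, ?_⟩, fun hs => ⟨?_, ?_⟩, fun hs => ?_⟩
    · exact fun h => not_hasInvariantLift_cI_two hs ((two _ _).1 h)
    · exact fun h => not_hasInvariantLift_cI_four (hs ▸ Subgroup.mem_zpowers _) ((one _ _).1 h)
    · exact (two _ _).2 (hasInvariantLift_cI_two (hG'.trans hr) hs)
    · exact (one _ _).2 (hasInvariantLift_cI_four (hG'.trans hr) hs)
  · rintro ⟨hII, -, hc, rfl⟩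
    rw [res_iota4]
    have hII' : TypeIICondition (conjSubgroup w G') := hII.mono (Subgroup.map_mono hG')
    have hsplit : IsSplit G' (p w '' {0}) → ¬ Reverses (conjSubgroup w G') 0 := fun h => by
      rw [reverses_conjSubgroup]
      refine h.not_reverses fun j hj => ⟨1, G'.one_mem, ?_⟩
      obtain ⟨i, rfl, rfl⟩ := hj
      simp
    refine ⟨fun hn => ⟨four_nsmul_iota4 _ _ _, ?_⟩, fun hs h1 h2 => ⟨?_, ?_⟩, fun hs h => ?_⟩
    · exact fun h => not_hasInvariantLift_cII_two (conjSubgroup_le_W (hG'.trans hG))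
        (reverses_conjSubgroup.2 (hn.reverses ⟨0, rfl, rfl⟩)) ((two _ _).1 h)
    · exact fun h => not_hasInvariantLift_cII_four h1.exists_reverses h2.exists_reverses
        ((one _ _).1 h)
    · exact (two _ _).2 (hasInvariantLift_cII_two hII' (hsplit hs))
    · have hB := hII'.preserves_blocks (hsplit hs)
      refine (one _ _).2 (h.elim (fun h => ?_) fun h => ?_)
      · exact hasInvariantLift_cII_four_of_first hII' (hsplit hs)
          (h.not_reverses hB.1 (by simp)) (h.not_reverses hB.1 (by simp))
      · exact hasInvariantLift_cII_four_of_second hII' (hsplit hs)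
          (h.not_reverses hB.2 (by simp)) (h.not_reverses hB.2 (by simp))
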